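/- Let $q$ be a prime power and let $n,k,s,t,h$ be integers with $n\ge 2$, $1\le k\le 2n-1$, $s,t\ge 1$, $h\ge 0$ and $\gcd(2n,s)=\gcd(2n,t)=1$. Let $N(x)=x^{1+q+\cdots+q^{2n-1}}$ denote the norm from $\mathbb F_{q^{2n}}$ to $\mathbb F_q$. Let $\gamma,\eta\in\mathbb F_{q^{2n}}$ be such that $N(\gamma)$ is a non-square in $\mathbb F_q$ and $N(\eta)\ne 1$. Put \[ \mathcal D_{k,s}(\gamma)=\Big\{aX+\sum_{i=1}^{k-1}c_iX^{q^{is}}+\gamma bX^{q^{ks}} : c_1,\dots,c_{k-1}\in\mathbb F_{q^{2n}},\ a,b\in\mathbb F_{q^n}\Big\}, \] \[ \mathcal H_{k,t}(\eta,h)=\Big\{\sum_{i=0}^{k-1}a_iX^{q^{it}}+\eta a_0^{q^h}X^{q^{kt}} : a_0,\dots,a_{k-1}\in\mathbb F_{q^{2n}}\Big\}. \] Each of these polynomials induces an $\mathbb F_q$-linear map of $\mathbb F_{q^{2n}}$; writing these maps as matrices with respect to a fixed (arbitrary) $\mathbb F_q$-basis of $\mathbb F_{q^{2n}}$, regard both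 sets as rank-metric codes in $\mathbb F_q^{2n\times 2n}$. Two codes $\mathcal C_1,\mathcal C_2\subseteq\mathbb F_q^{2n\times 2n}$ are called equivalent if there are $A,B\in\mathrm{GL}_{2n}(\mathbb F_q)$, $C\in\mathbb F_q^{2n\times 2n}$ and $\rho\in\mathrm{Aut}(\mathbb F_q)$, applied entrywise, such that $\mathcal C_2=\{AM^{\rho}B+C : M\in\mathcal C_1\}$. Then $\mathcal D_{k,s}(\gamma)$ and $\mathcal H_{k,t}(\eta,h)$ are not equivalent. -/

import Mathlib

namespace RankMetric

/-- Equivalence of rank-metric codes: `C₂ = {A M^ρ B + Z : M ∈ C₁}` with `A`, `B` invertible, `Z` an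
arbitrary matrix, and `ρ` a field automorphism applied to every entry of `M`. -/
def Equivalent {K : Type*} [Field K] {m n : Type*} [Fintype m] [DecidableEq m] [Fintype n]
    [DecidableEq n] (C₁ C₂ : Set (Matrix m n K)) : Prop :=
  ∃ (A : GL m K) (B : GL n K) (Z : Matrix m n K) (ρ : K ≃+* K),
    C₂ = {M' | ∃ M ∈ C₁, M' = A.val * M.map ρ * B.val + Z}

variable (K : Type*) [Field K] [Fintype K] {L : Type*} [Field L] [Algebra K L]

/-- The `K`-linear map `x ↦ a * x ^ (q ^ i)` of `L` given by the `q`-monomial `a X^(q^i)`, where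
`q = #K`. -/
noncomputable def qMonomial (a : L) (i : ℕ) : L →ₗ[K] L :=
  LinearMap.mulLeft K a ∘ₗ ((FiniteField.frobeniusAlgHom K L) ^ i).toLinearMap

theorem qMonomial_apply (a : L) (i : ℕ) (x : L) :
    qMonomial K a i x = a * x ^ (Fintype.card K ^ i) := by
  simp [qMonomial, AlgHom.coe_pow, FiniteField.coe_frobeniusAlgHom, pow_iterate]

/-- The elements of the subfield with `q ^ n` elements, `q = #K` (for `L` finite of degree
divisible by `n` over `K`). -/
def subfieldElems (L : Type*) [Field L] (n : ℕ) : Set L :=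
  {a | a ^ (Fintype.card K ^ n) = a}

/-- The code `D_{k,s}(γ)`, as a set of `K`-linear maps of `L`, where `[L : K] = 2n`: the maps of
the `q`-polynomials `a X + ∑_{i=1}^{k-1} c_i X^(q^(is)) + γ b X^(q^(ks))` with `c_i` in `L` and
`a`, `b` in the subfield with `q^n` elements. -/
def codeD (n k s : ℕ) (γ : L) : Set (L →ₗ[K] L) :=
  {f | ∃ a ∈ subfieldElems K L n, ∃ b ∈ subfieldElems K L n, ∃ c : ℕ → L,
    f = qMonomial K a 0 + ∑ i ∈ Finset.Ico 1 k, qMonomial K (c i) (i * s)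
      + qMonomial K (γ * b) (k * s)}

/-- The generalized twisted Gabidulin code `H_{k,t}(η,h)`, as a set of `K`-linear maps of `L`: the
maps of the `q`-polynomials `∑_{i=0}^{k-1} a_i X^(q^(it)) + η a_0^(q^h) X^(q^(kt))` with `a_i`
in `L`. -/
def codeH (k t : ℕ) (η : L) (h : ℕ) : Set (L →ₗ[K] L) :=
  {f | ∃ a : ℕ → L,
    f = ∑ i ∈ Finset.range k, qMonomial K (a i) (i * t)
      + qMonomial K (η * a 0 ^ (Fintype.card K ^ h)) (k * t)}

/-- The matrix code over `K` of a set of `K`-linear maps of `L`, with respect to a basis. -/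
def matrixCode {K L ι : Type*} [Field K] [Field L] [Algebra K L] [Fintype ι] [DecidableEq ι]
    (β : Module.Basis ι K L) (S : Set (L →ₗ[K] L)) : Set (Matrix ι ι K) :=
  LinearMap.toMatrix β β '' S

end RankMetric

/-! The invariant is the pair of sizes of the left and right idealizers. The translation in an
equivalence onto an additive code drops out when the source contains `0`. The rest is a ring
isomorphism followed by multiplication by units, which only conjugates idealizers
(`Equivalent.ncard_idealizers`).

By Dedekind independence every `K`-endomorphism of `L` is uniquely `∑ c_ρ ρ` over the Galois group,
which is generated by `σ = frob ^ s` (or `frob ^ t`). Each code consists of the `∑_{i ≤ k} c_i σ^i`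
with free middle coefficients and one condition on `c_0, c_k`. Testing against few elements forces
idealizers to consist of multiplications by scalars. For `D` both are the field of `q^n` elements.
For `H`, outside degenerate cases, they are the scalars fixed by `frob ^ h` and those on which `frob
^ h` and `frob ^ (k * t)` agree, of sizes `q^gcd(2n,h)` and `q^gcd(2n,h-kt)`.

Equivalence would make both gcds `n`. Then `n ∣ kt`, so `n ∣ k` and `k = n`; now `h/n`, `(h-kt)/n`
and `t` are all odd although the first is congruent mod 2 to the sum of the others
(`false_of_gcd_eq`). If `η = 0` or `frob ^ h` is `1` or `frob ^ (k * t)`, one idealizer of `H`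
contains all of `L`, which is too large. -/

namespace RankMetric

/-! ### Idealizers and their invariance under equivalence. -/

section Idealizers

variable {R : Type*} [Ring R]

/-- The elements `g` of a ring with `g S ⊆ S`. -/
def leftIdealizer (S : Set R) : Set R := {g | ∀ f ∈ S, g * f ∈ S}

/-- The elements `g` of a ring with `S g ⊆ S`. -/
def rightIdealizer (S : Set R) : Set R := {g | ∀ f ∈ S, f * g ∈ S}

theorem leftIdealizer_image {R' : Type*} [Ring R'] (e : R ≃+* R') (S : Set R) :
    leftIdealizer (e '' S) = e '' leftIdealizer S := by
  ext g
  obtain ⟨g, rfl⟩ := e.surjective g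
  simp [leftIdealizer, ← map_mul]

theorem rightIdealizer_image {R' : Type*} [Ring R'] (e : R ≃+* R') (S : Set R) :
    rightIdealizer (e '' S) = e '' rightIdealizer S := by
  ext g
  obtain ⟨g, rfl⟩ := e.surjective g
  simp [rightIdealizer, ← map_mul]

/-- The left idealizer is conjugated by `u`, while `v` cancels; on the right the roles are
exchanged. -/
theorem ncard_leftIdealizer_units (u v : Rˣ) (S : Set R) :
    (leftIdealizer ((fun f => (u : R) * f * v) '' S)).ncard = (leftIdealizer S).ncard := by
  have h : leftIdealizer ((fun f => (u : R) * f * v) '' S) =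
      (fun g => (u : R) * g * (u⁻¹ : Rˣ)) '' leftIdealizer S := by
    ext g
    constructor
    · intro hg
      refine ⟨(u⁻¹ : Rˣ) * g * u, fun f hf => ?_, by simp [mul_assoc]⟩
      obtain ⟨f', hf', he⟩ := hg _ ⟨f, hf, rfl⟩
      have : (u⁻¹ : Rˣ) * g * u * f = f' := by
        have := congrArg (fun x : R => ((u⁻¹ : Rˣ) : R) * x * ((v⁻¹ : Rˣ) : R)) he
        simpa [mul_assoc] using this.symm
      rwa [this]
    · rintro ⟨g, hg, rfl⟩ _ ⟨f, hf, rfl⟩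
      exact ⟨g * f, hg f hf, by simp [mul_assoc]⟩
  rw [h]
  exact Set.ncard_image_of_injective _ fun x y hxy => by simpa using hxy

theorem ncard_rightIdealizer_units (u v : Rˣ) (S : Set R) :
    (rightIdealizer ((fun f => (u : R) * f * v) '' S)).ncard = (rightIdealizer S).ncard := by
  have h : rightIdealizer ((fun f => (u : R) * f * v) '' S) =
      (fun g => (v⁻¹ : Rˣ) * g * (v : R)) '' rightIdealizer S := by
    ext g
    constructor
    · intro hg
      refine ⟨v * g * (v⁻¹ : Rˣ), fun f hf => ?_, by simp [mul_assoc]⟩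
      obtain ⟨f', hf', he⟩ := hg _ ⟨f, hf, rfl⟩
      have : f * (v * g * (v⁻¹ : Rˣ)) = f' := by
        have := congrArg (fun x : R => ((u⁻¹ : Rˣ) : R) * x * ((v⁻¹ : Rˣ) : R)) he
        simpa [mul_assoc] using this.symm
      rwa [this]
    · rintro ⟨g, hg, rfl⟩ _ ⟨f, hf, rfl⟩
      exact ⟨f * g, hg f hf, by simp [mul_assoc]⟩
  rw [h]
  exact Set.ncard_image_of_injective _ fun x y hxy => by simpa using hxy

/-- The translation part of an equivalence onto an additive code can be dropped. -/
theorem Equivalent.exists_image_eq {K : Type*} [Field K] {m : Type*} [Fintype m] [DecidableEq m]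
    {C₁ : Set (Matrix m m K)} (C₂ : AddSubgroup (Matrix m m K)) (h₁ : (0 : Matrix m m K) ∈ C₁)
    (h : Equivalent C₁ (C₂ : Set (Matrix m m K))) :
    ∃ (A B : GL m K) (ρ : K ≃+* K), (C₂ : Set (Matrix m m K)) =
      (fun M => A.val * M * B.val) '' (ρ.mapMatrix '' C₁) := by
  obtain ⟨A, B, Z, ρ, h⟩ := h
  -- `Z` is the image of the zero matrix.
  have hZ : Z ∈ C₂ := by
    have : Z ∈ (C₂ : Set (Matrix m m K)) := by
      rw [h]
      exact ⟨0, h₁, by simp⟩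
    exact this
  refine ⟨A, B, ρ, ?_⟩
  ext M
  rw [Set.image_image]
  have hM : M ∈ C₂ ↔ M + Z ∈ (C₂ : Set (Matrix m m K)) := (C₂.add_mem_cancel_right hZ).symm
  rw [SetLike.mem_coe, hM, h]
  constructor
  · rintro ⟨N, hN, he⟩
    exact ⟨N, hN, by simpa using (add_right_cancel he).symm⟩
  · rintro ⟨N, hN, rfl⟩
    exact ⟨N, hN, by simp⟩

theorem Equivalent.ncard_idealizers {K L ι : Type*} [Field K] [Field L] [Algebra K L]
    [Fintype ι] [DecidableEq ι] (β : Module.Basis ι K L) {S : Set (Module.End K L)}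
    (T : AddSubgroup (Module.End K L)) (h₁ : (0 : Module.End K L) ∈ S)
    (h : Equivalent (matrixCode β S) (matrixCode β (T : Set (Module.End K L)))) :
    (leftIdealizer (T : Set (Module.End K L))).ncard = (leftIdealizer S).ncard ∧
    (rightIdealizer (T : Set (Module.End K L))).ncard = (rightIdealizer S).ncard := by
  let e : Module.End K L ≃+* Matrix ι ι K := (LinearMap.toMatrixAlgEquiv β).toRingEquiv
  have hcode (S : Set (Module.End K L)) : matrixCode β S = e '' S := rfl
  have hT : (T.map (e : Module.End K L →+ Matrix ι ι K) : Set (Matrix ι ι K)) = e '' T := rfl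
  rw [hcode, hcode, ← hT] at h
  obtain ⟨A, B, ρ, h⟩ := Equivalent.exists_image_eq _
    (show (0 : Matrix ι ι K) ∈ e '' S from ⟨0, h₁, map_zero e⟩) h
  rw [hT] at h
  constructor
  · rw [← Set.ncard_image_of_injective _ e.injective, ← leftIdealizer_image, h,
      ncard_leftIdealizer_units, leftIdealizer_image, leftIdealizer_image,
      Set.ncard_image_of_injective _ (ρ.mapMatrix).injective,
      Set.ncard_image_of_injective _ e.injective]
  · rw [← Set.ncard_image_of_injective _ e.injective, ← rightIdealizer_image, h,
      ncard_rightIdealizer_units, rightIdealizer_image, rightIdealizer_image,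
      Set.ncard_image_of_injective _ (ρ.mapMatrix).injective,
      Set.ncard_image_of_injective _ e.injective]

end Idealizers

/-! ### Endomorphisms of `L` as combinations of automorphisms. -/

section Coefficients

variable {K L : Type*} [Field K] [Field L] [Algebra K L]

/-- The `K`-linear map `x ↦ a * ρ x`. -/
def galMonomial (a : L) (ρ : L ≃ₐ[K] L) : Module.End K L :=
  LinearMap.mulLeft K a * ρ.toLinearMap

@[simp]
theorem galMonomial_apply (a : L) (ρ : L ≃ₐ[K] L) (x : L) : galMonomial a ρ x = a * ρ x := rfl

theorem galMonomial_one_injective :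
    Function.Injective fun c : L => galMonomial c (1 : L ≃ₐ[K] L) := fun a b h => by
  simpa using LinearMap.congr_fun h 1

theorem eq_zero_of_forall_fixed {φ : L ≃ₐ[K] L} (hφ : φ ≠ 1) {u : L}
    (h : ∀ a, φ (u * a) = u * a) : u = 0 := by
  by_contra hu
  exact hφ (AlgEquiv.ext fun x => by simpa [hu] using h (u⁻¹ * x))

/-- The condition `a_0 ∈ Fix φ`, `a_k ∈ γ Fix φ` on extreme coefficients. -/
def FixedPair (φ : L ≃ₐ[K] L) (γ x y : L) : Prop := φ x = x ∧ ∃ b, φ b = b ∧ y = γ * b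

theorem FixedPair.eq_zero {φ : L ≃ₐ[K] L} (hφ : φ ≠ 1) {γ : L} (hγ : γ ≠ 0) {u v : L}
    {μ ν : L ≃ₐ[K] L} (h : ∀ a, FixedPair φ γ (u * μ a) (v * ν a)) : u = 0 ∧ v = 0 := by
  constructor
  · exact eq_zero_of_forall_fixed hφ fun a => by simpa using (h (μ.symm a)).1
  · have : γ⁻¹ * v = 0 := eq_zero_of_forall_fixed hφ fun a => by
      obtain ⟨b, hb, he⟩ := (h (ν.symm a)).2
      rw [AlgEquiv.apply_symm_apply] at he
      rwa [mul_assoc, he, inv_mul_cancel_left₀ hγ]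
    simpa [hγ] using this

theorem linearIndependent_gal :
    LinearIndependent L (fun ρ : L ≃ₐ[K] L => (ρ.toLinearMap : L →ₗ[K] L)) :=
  (linearIndependent_toLinearMap K L L).comp (fun ρ : L ≃ₐ[K] L => (ρ : L →ₐ[K] L))
    AlgEquiv.coe_toAlgHom_injective

variable [FiniteDimensional K L] [IsGalois K L]

/-- The automorphisms of a finite Galois extension `L / K` form an `L`-basis of the `K`-linear
endomorphisms of `L`. -/
noncomputable def galBasis : Module.Basis (L ≃ₐ[K] L) L (L →ₗ[K] L) :=
  basisOfLinearIndependentOfCardEqFinrank linearIndependent_gal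
    (by rw [Module.finrank_linearMap_self, Fintype.card_eq_nat_card,
          IsGalois.card_aut_eq_finrank])

@[simp]
theorem galBasis_apply (ρ : L ≃ₐ[K] L) (x : L) : galBasis (K := K) ρ x = ρ x :=
  LinearMap.congr_fun (congrFun
    (coe_basisOfLinearIndependentOfCardEqFinrank linearIndependent_gal _) ρ) x

/-- The coefficient of `ρ` in the expansion of an endomorphism in the basis of automorphisms. -/
noncomputable def galCoeff (f : Module.End K L) (ρ : L ≃ₐ[K] L) : L := galBasis.repr f ρ

theorem sum_galCoeff (f : Module.End K L) (x : L) : f x = ∑ ρ : L ≃ₐ[K] L, galCoeff f ρ * ρ x := by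
  have h := LinearMap.congr_fun (galBasis.sum_repr f) x
  rw [← h, LinearMap.sum_apply]
  simp [galCoeff]

theorem galCoeff_eq_of_sum {f : Module.End K L} {c : (L ≃ₐ[K] L) → L}
    (h : ∀ x, f x = ∑ ρ, c ρ * ρ x) (ρ : L ≃ₐ[K] L) : galCoeff f ρ = c ρ := by
  have hf : f = ∑ ρ, c ρ • (galBasis ρ : L →ₗ[K] L) := by
    ext x
    rw [h x, LinearMap.sum_apply]
    simp
  rw [galCoeff, hf, galBasis.repr_sum_self]

theorem ext_galCoeff {f g : Module.End K L} (h : ∀ ρ, galCoeff f ρ = galCoeff g ρ) : f = g := by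
  ext x
  simp [sum_galCoeff f, sum_galCoeff g, h]

@[simp]
theorem galCoeff_zero (ρ : L ≃ₐ[K] L) : galCoeff (0 : Module.End K L) ρ = 0 := by simp [galCoeff]

@[simp]
theorem galCoeff_add (f g : Module.End K L) (ρ : L ≃ₐ[K] L) :
    galCoeff (f + g) ρ = galCoeff f ρ + galCoeff g ρ := by simp [galCoeff]

@[simp]
theorem galCoeff_neg (f : Module.End K L) (ρ : L ≃ₐ[K] L) :
    galCoeff (-f) ρ = -galCoeff f ρ := by simp [galCoeff]

theorem galCoeff_sum {ι : Type*} (s : Finset ι) (f : ι → Module.End K L) (ρ : L ≃ₐ[K] L) :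
    galCoeff (∑ i ∈ s, f i) ρ = ∑ i ∈ s, galCoeff (f i) ρ := by
  classical
  induction s using Finset.induction_on with
  | empty => simp
  | insert i s hi ih => simp [Finset.sum_insert hi, ih]

open Classical in
theorem galCoeff_galMonomial (a : L) (τ ρ : L ≃ₐ[K] L) :
    galCoeff (galMonomial a τ) ρ = if ρ = τ then a else 0 :=
  galCoeff_eq_of_sum (c := fun ρ => if ρ = τ then a else 0) (by simp) ρ

theorem galCoeff_mul_galMonomial (f : Module.End K L) (a : L) (τ ρ : L ≃ₐ[K] L) :
    galCoeff (f * galMonomial a τ) ρ = galCoeff f (ρ * τ⁻¹) * (ρ * τ⁻¹) a := by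
  refine galCoeff_eq_of_sum (c := fun ρ => galCoeff f (ρ * τ⁻¹) * (ρ * τ⁻¹) a) (fun x => ?_) ρ
  rw [← Equiv.sum_comp (Equiv.mulRight τ), Module.End.mul_apply, sum_galCoeff]
  simp [mul_assoc]

theorem galCoeff_galMonomial_mul (f : Module.End K L) (a : L) (τ ρ : L ≃ₐ[K] L) :
    galCoeff (galMonomial a τ * f) ρ = a * τ (galCoeff f (τ⁻¹ * ρ)) := by
  refine galCoeff_eq_of_sum (c := fun ρ => a * τ (galCoeff f (τ⁻¹ * ρ))) (fun x => ?_) ρ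
  rw [← Equiv.sum_comp (Equiv.mulLeft τ), Module.End.mul_apply, galMonomial_apply, sum_galCoeff]
  simp [Finset.mul_sum, mul_assoc]

/-- Linear independence of two distinct automorphisms, the tool for the twisted code. -/
theorem eq_zero_of_mul_eq_mul {ν ν' : L ≃ₐ[K] L} (h : ν ≠ ν') {x y : L}
    (hxy : ∀ a, x * ν a = y * ν' a) : x = 0 ∧ y = 0 := by
  have he : galMonomial x ν = galMonomial y ν' := by
    ext a
    simp [hxy]
  have h₁ := congrArg (galCoeff · ν) he
  have h₂ := congrArg (galCoeff · ν') he
  simp only [galCoeff_galMonomial, if_true, if_neg h, if_neg h.symm] at h₁ h₂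
  exact ⟨h₁, h₂.symm⟩

end Coefficients

/-! ### Idealizers of codes given by a condition on the extreme coefficients. -/

section CoefficientCodes

variable {K L : Type*} [Field K] [Field L] [Algebra K L] [FiniteDimensional K L] [IsGalois K L]

/-- The endomorphisms `∑_{i=0}^{k} a_i σ^i` of `L` for which `P a_0 a_k` holds. -/
def coeffCode (σ : L ≃ₐ[K] L) (k : ℕ) (P : L → L → Prop) : Set (Module.End K L) :=
  {f | P (galCoeff f 1) (galCoeff f (σ ^ k)) ∧
    ∀ j, k < j → j < orderOf σ → galCoeff f (σ ^ j) = 0}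

theorem pow_ne_pow_of_lt {G : Type*} [Group G] {σ : G} {i j : ℕ} (h : i < j)
    (hj : j < orderOf σ) : σ ^ i ≠ σ ^ j := fun he =>
  h.ne (pow_injOn_Iio_orderOf (Set.mem_Iio.2 (h.trans hj)) (Set.mem_Iio.2 hj) he)

theorem exists_pow_eq_of_mem_zpowers {G : Type*} [Group G] [Finite G] {σ ρ : G}
    (h : ρ ∈ Subgroup.zpowers σ) : ∃ i < orderOf σ, σ ^ i = ρ := by
  classical
  simpa using mem_zpowers_iff_mem_range_orderOf.1 h

theorem eq_galMonomial_one {σ : L ≃ₐ[K] L} (hσ : ∀ ρ, ρ ∈ Subgroup.zpowers σ)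
    {g : Module.End K L} (hg : ∀ i, 1 ≤ i → i < orderOf σ → galCoeff g (σ ^ i) = 0) :
    g = galMonomial (galCoeff g 1) 1 := by
  refine ext_galCoeff fun ρ => ?_
  rw [galCoeff_galMonomial]
  obtain ⟨i, hi, rfl⟩ := exists_pow_eq_of_mem_zpowers (hσ ρ)
  rcases Nat.eq_zero_or_pos i with rfl | h0
  · simp
  · rw [hg i h0 hi, if_neg]
    simpa using (pow_ne_pow_of_lt h0 hi).symm

theorem galMonomial_mem_coeffCode {σ : L ≃ₐ[K] L} {k : ℕ} (hk : k < orderOf σ)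
    {P : L → L → Prop} (h0 : P 0 0) {j : ℕ} (hj : 1 ≤ j) (hjk : j < k) (a : L) :
    galMonomial a (σ ^ j) ∈ coeffCode σ k P := by
  refine ⟨?_, fun i hi hi' => ?_⟩
  · rw [galCoeff_galMonomial, galCoeff_galMonomial, if_neg, if_neg]
    · exact h0
    · exact (pow_ne_pow_of_lt hjk hk).symm
    · simpa using pow_ne_pow_of_lt hj (hjk.trans hk)
  · rw [galCoeff_galMonomial, if_neg]
    exact (pow_ne_pow_of_lt (hjk.trans hi) hi').symm

theorem inv_eq_pow_orderOf_sub_one {G : Type*} [Group G] {σ : G} (h : 0 < orderOf σ) :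
    σ⁻¹ = σ ^ (orderOf σ - 1) := by
  rw [inv_eq_iff_mul_eq_one, ← pow_succ', Nat.sub_add_cancel h, pow_orderOf_eq_one]

/-- With `m = orderOf σ`, the exponents `1, …, k-1` are covered by `k - j`, the exponents `k, …,
m-2` by `hbig`, and `m-1` by the inverse with `j = 1`. -/
theorem eq_galMonomial_one_of_vanishing {σ : L ≃ₐ[K] L} (hσ : ∀ ρ, ρ ∈ Subgroup.zpowers σ) {k : ℕ}
    (hk : 2 ≤ k) {g : Module.End K L}
    (hinv : ∀ j, 1 ≤ j → j < k → galCoeff g (σ ^ j)⁻¹ = 0 ∧ galCoeff g (σ ^ (k - j)) = 0)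
    (hbig : ∀ i, k < i + 1 → i + 1 < orderOf σ → galCoeff g (σ ^ i) = 0) :
    g = galMonomial (galCoeff g 1) 1 := by
  refine eq_galMonomial_one hσ fun i hi hi' => ?_
  by_cases hik : i < k
  · have := (hinv (k - i) (by omega) (by omega)).2
    rwa [Nat.sub_sub_self hik.le] at this
  by_cases him : i + 1 < orderOf σ
  · exact hbig i (by omega) him
  · have := (hinv 1 le_rfl hk).1
    rwa [pow_one, inv_eq_pow_orderOf_sub_one (by omega), show orderOf σ - 1 = i by omega] at this

/-- The code contains `a σ^j` for every `a` when `0 < j < k`. The extreme coefficients of `g * (a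
σ^j)` come from `g` at `σ^(-j)` and `σ^(k-j)`, so `hP` kills both. The product with `σ` itself
shifts `g` by one and kills the high exponents. -/
theorem eq_galMonomial_one_of_mem_leftIdealizer {σ : L ≃ₐ[K] L}
    (hσ : ∀ ρ, ρ ∈ Subgroup.zpowers σ) {k : ℕ} (hk : 2 ≤ k) (hk' : k < orderOf σ)
    {P : L → L → Prop} (h0 : P 0 0)
    (hP : ∀ j, 1 ≤ j → j < k → ∀ u v : L,
      (∀ a, P (u * (σ ^ j)⁻¹ a) (v * (σ ^ (k - j)) a)) → u = 0 ∧ v = 0)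
    {g : Module.End K L} (hg : g ∈ leftIdealizer (coeffCode σ k P)) :
    g = galMonomial (galCoeff g 1) 1 := by
  refine eq_galMonomial_one_of_vanishing hσ hk (fun j hj hjk => hP j hj hjk _ _ fun a => ?_)
    fun i hi hi' => ?_
  · have h := (hg _ (galMonomial_mem_coeffCode hk' h0 hj hjk a)).1
    rwa [galCoeff_mul_galMonomial, galCoeff_mul_galMonomial, one_mul, ← pow_sub σ hjk.le] at h
  · have h := (hg _ (galMonomial_mem_coeffCode hk' h0 le_rfl hk 1)).2 _ hi hi'
    rwa [galCoeff_mul_galMonomial, map_one, mul_one, ← pow_sub σ (by omega),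
      Nat.add_sub_cancel] at h

theorem eq_galMonomial_one_of_mem_rightIdealizer {σ : L ≃ₐ[K] L}
    (hσ : ∀ ρ, ρ ∈ Subgroup.zpowers σ) {k : ℕ} (hk : 2 ≤ k) (hk' : k < orderOf σ)
    {P : L → L → Prop} (h0 : P 0 0)
    (hP : ∀ u v : L, (∀ a, P (a * u) (a * v)) → u = 0 ∧ v = 0)
    {g : Module.End K L} (hg : g ∈ rightIdealizer (coeffCode σ k P)) :
    g = galMonomial (galCoeff g 1) 1 := by
  have hcomm (i j : ℕ) (h : j ≤ i) : (σ ^ j)⁻¹ * σ ^ i = σ ^ (i - j) := by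
    rw [inv_mul_eq_iff_eq_mul, ← pow_add, Nat.add_sub_cancel' h]
  refine eq_galMonomial_one_of_vanishing hσ hk (fun j hj hjk => ?_) fun i hi hi' => ?_
  · have := hP (σ ^ j <| galCoeff g (σ ^ j)⁻¹) (σ ^ j <| galCoeff g (σ ^ (k - j))) fun a => by
      have h := (hg _ (galMonomial_mem_coeffCode hk' h0 hj hjk a)).1
      rwa [galCoeff_galMonomial_mul, galCoeff_galMonomial_mul, mul_one, hcomm _ _ hjk.le] at h
    simpa only [EmbeddingLike.map_eq_zero_iff] using this
  · have h := (hg _ (galMonomial_mem_coeffCode hk' h0 le_rfl hk 1)).2 _ hi hi'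
    rwa [galCoeff_galMonomial_mul, one_mul, EmbeddingLike.map_eq_zero_iff, hcomm _ _ (by omega),
      Nat.add_sub_cancel] at h

theorem galCoeff_galMonomial_one_mul (c : L) (f : Module.End K L) (ρ : L ≃ₐ[K] L) :
    galCoeff (galMonomial c 1 * f) ρ = c * galCoeff f ρ := by
  simp [galCoeff_galMonomial_mul]

theorem galCoeff_mul_galMonomial_one (c : L) (f : Module.End K L) (ρ : L ≃ₐ[K] L) :
    galCoeff (f * galMonomial c 1) ρ = galCoeff f ρ * ρ c := by
  simp [galCoeff_mul_galMonomial]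

theorem galMonomial_one_mem_fixedPair {σ : L ≃ₐ[K] L} {k : ℕ} (hk : 1 ≤ k) (hk' : k < orderOf σ)
    (φ : L ≃ₐ[K] L) (γ : L) : galMonomial 1 1 ∈ coeffCode σ k (FixedPair φ γ) := by
  have hk1 : (1 : L ≃ₐ[K] L) ≠ σ ^ k := by simpa using pow_ne_pow_of_lt hk hk'
  refine ⟨?_, fun j hj hj' => ?_⟩
  · simp only [galCoeff_galMonomial, if_true, if_neg hk1.symm]
    exact ⟨map_one φ, 0, map_zero φ, by simp⟩
  · rw [galCoeff_galMonomial, if_neg]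
    simpa using (pow_ne_pow_of_lt (Nat.zero_lt_of_lt hj) hj').symm

theorem galMonomial_mem_fixedPair {σ : L ≃ₐ[K] L} {k : ℕ} (hk : 1 ≤ k) (hk' : k < orderOf σ)
    (φ : L ≃ₐ[K] L) (γ : L) : galMonomial γ (σ ^ k) ∈ coeffCode σ k (FixedPair φ γ) := by
  have hk1 : (1 : L ≃ₐ[K] L) ≠ σ ^ k := by simpa using pow_ne_pow_of_lt hk hk'
  refine ⟨?_, fun j hj hj' => ?_⟩
  · simp only [galCoeff_galMonomial, if_true, if_neg hk1]
    exact ⟨map_zero φ, 1, map_one φ, by simp⟩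
  · rw [galCoeff_galMonomial, if_neg]
    exact (pow_ne_pow_of_lt hj hj').symm

theorem leftIdealizer_fixedPair {σ φ : L ≃ₐ[K] L} (hσ : ∀ ρ, ρ ∈ Subgroup.zpowers σ)
    (hm : 2 < orderOf σ) {k : ℕ} (hk : 1 ≤ k) (hk' : k < orderOf σ) (hφ : φ ≠ 1)
    {γ : L} (hγ : γ ≠ 0) :
    leftIdealizer (coeffCode σ k (FixedPair φ γ)) =
      (fun c => galMonomial c (1 : L ≃ₐ[K] L)) '' {c | φ c = c} := by
  have h0 : FixedPair φ γ 0 0 := ⟨map_zero φ, 0, map_zero φ, by simp⟩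
  ext g
  constructor
  · intro hg
    -- The identity map lies in the code, so its idealizer is contained in it.
    have hgone : g ∈ coeffCode σ k (FixedPair φ γ) := by
      have h : g * galMonomial 1 1 = g := by ext; simp
      simpa [h] using hg _ (galMonomial_one_mem_fixedPair hk hk' φ γ)
    refine ⟨galCoeff g 1, hgone.1.1, Eq.symm ?_⟩
    -- For `k = 1` there are no middle monomials; `γ σ` is used instead, and its product with `g`
    -- must vanish at `σ^2`, an exponent below the order since `2 < orderOf σ`.
    rcases hk.eq_or_lt with rfl | hk2
    · refine eq_galMonomial_one hσ fun i hi hi' => ?_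
      rcases hi.eq_or_lt with rfl | hi
      · have h := (hg _ (galMonomial_mem_fixedPair le_rfl hk' φ γ)).2 2 one_lt_two hm
        rw [galCoeff_mul_galMonomial, pow_two, pow_one, mul_inv_cancel_right] at h
        simpa [hγ] using h
      · exact hgone.2 i hi hi'
    · exact eq_galMonomial_one_of_mem_leftIdealizer hσ hk2 hk' h0
        (fun j _ _ u v h => FixedPair.eq_zero hφ hγ h) hg
  · rintro ⟨c, hc, rfl⟩ f ⟨⟨h1, b, hb, h2⟩, h3⟩
    rw [Set.mem_ofPred_eq] at hc
    refine ⟨?_, fun j hj hj' => ?_⟩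
    · simp only [galCoeff_galMonomial_one_mul]
      exact ⟨by rw [map_mul, hc, h1], c * b, by rw [map_mul, hc, hb], by rw [h2]; ring⟩
    · simp [galCoeff_galMonomial_one_mul, h3 j hj hj']

theorem rightIdealizer_fixedPair {σ φ : L ≃ₐ[K] L} (hσ : ∀ ρ, ρ ∈ Subgroup.zpowers σ)
    (hm : 2 < orderOf σ) {k : ℕ} (hk : 1 ≤ k) (hk' : k < orderOf σ) (hφ : φ ≠ 1)
    {γ : L} (hγ : γ ≠ 0) :
    rightIdealizer (coeffCode σ k (FixedPair φ γ)) =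
      (fun c => galMonomial c (1 : L ≃ₐ[K] L)) '' {c | φ c = c} := by
  have h0 : FixedPair φ γ 0 0 := ⟨map_zero φ, 0, map_zero φ, by simp⟩
  ext g
  constructor
  · intro hg
    have hgone : g ∈ coeffCode σ k (FixedPair φ γ) := by
      have h : galMonomial 1 1 * g = g := by ext; simp
      simpa [h] using hg _ (galMonomial_one_mem_fixedPair hk hk' φ γ)
    refine ⟨galCoeff g 1, hgone.1.1, Eq.symm ?_⟩
    rcases hk.eq_or_lt with rfl | hk2
    · refine eq_galMonomial_one hσ fun i hi hi' => ?_
      rcases hi.eq_or_lt with rfl | hi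
      · have h := (hg _ (galMonomial_mem_fixedPair le_rfl hk' φ γ)).2 2 one_lt_two hm
        rw [galCoeff_galMonomial_mul, pow_two, pow_one, inv_mul_cancel_left] at h
        simpa [hγ] using h
      · exact hgone.2 i hi hi'
    · exact eq_galMonomial_one_of_mem_rightIdealizer hσ hk2 hk' h0
        (fun u v h => FixedPair.eq_zero (μ := 1) (ν := 1) hφ hγ
          fun a => by simpa [mul_comm] using h a) hg
  · rintro ⟨c, hc, rfl⟩ f ⟨⟨h1, b, hb, h2⟩, h3⟩
    rw [Set.mem_ofPred_eq] at hc
    -- The Galois group is cyclic, so `σ ^ k` preserves the fixed field of `φ`.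
    have hcomm : φ * σ ^ k = σ ^ k * φ := by
      obtain ⟨i, rfl⟩ := Subgroup.mem_zpowers_iff.1 (hσ φ)
      rw [← zpow_natCast, ← zpow_add, ← zpow_add, add_comm]
    have hc' : φ ((σ ^ k) c) = (σ ^ k) c := by
      have := AlgEquiv.congr_fun hcomm c
      rwa [AlgEquiv.mul_apply, AlgEquiv.mul_apply, hc] at this
    refine ⟨?_, fun j hj hj' => ?_⟩
    · simp only [galCoeff_mul_galMonomial_one]
      exact ⟨by rw [AlgEquiv.one_apply, map_mul, hc, h1], b * (σ ^ k) c,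
        by rw [map_mul, hc', hb], by rw [h2]; ring⟩
    · simp [galCoeff_mul_galMonomial_one, h3 j hj hj']

/-- The condition `a_k = η θ(a_0)` on extreme coefficients. -/
def TwistedPair (θ : L ≃ₐ[K] L) (η x y : L) : Prop := y = η * θ x

/-- Separate from the exact computation because it also covers the degenerate cases, where every `c`
qualifies. -/
theorem galMonomial_mem_leftIdealizer_twistedPair (σ θ : L ≃ₐ[K] L) (k : ℕ) {η c : L}
    (hc : η = 0 ∨ θ c = c) :
    galMonomial c 1 ∈ leftIdealizer (coeffCode σ k (TwistedPair θ η)) := by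
  rintro f ⟨h1, h2⟩
  refine ⟨?_, fun j hj hj' => ?_⟩
  · rw [TwistedPair] at h1 ⊢
    rcases hc with rfl | hc
    · simp [galCoeff_galMonomial_one_mul, h1]
    · rw [galCoeff_galMonomial_one_mul, galCoeff_galMonomial_one_mul, h1, map_mul, hc]
      ring
  · simp [galCoeff_galMonomial_one_mul, h2 j hj hj']

theorem galMonomial_mem_rightIdealizer_twistedPair {σ θ : L ≃ₐ[K] L} {k : ℕ} {η c : L}
    (hc : θ c = (σ ^ k) c) :
    galMonomial c 1 ∈ rightIdealizer (coeffCode σ k (TwistedPair θ η)) := by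
  rintro f ⟨h1, h2⟩
  refine ⟨?_, fun j hj hj' => ?_⟩
  · rw [TwistedPair] at h1 ⊢
    rw [galCoeff_mul_galMonomial_one, galCoeff_mul_galMonomial_one, h1, map_mul,
      AlgEquiv.one_apply, hc]
    ring
  · simp [galCoeff_mul_galMonomial_one, h2 j hj hj']

theorem twist_mem_coeffCode {σ : L ≃ₐ[K] L} {k : ℕ} (hk : 1 ≤ k) (hk' : k < orderOf σ)
    (θ : L ≃ₐ[K] L) (η a : L) :
    galMonomial a 1 + galMonomial (η * θ a) (σ ^ k) ∈ coeffCode σ k (TwistedPair θ η) := by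
  have hk1 : (1 : L ≃ₐ[K] L) ≠ σ ^ k := by simpa using pow_ne_pow_of_lt hk hk'
  refine ⟨?_, fun j hj hj' => ?_⟩
  · simp [galCoeff_galMonomial, if_neg hk1, if_neg hk1.symm, TwistedPair]
  · rw [galCoeff_add, galCoeff_galMonomial, galCoeff_galMonomial, if_neg, if_neg, add_zero]
    · exact (pow_ne_pow_of_lt hj hj').symm
    · simpa using (pow_ne_pow_of_lt (Nat.zero_lt_of_lt hj) hj').symm

/-- Membership conditions have the form `x ν(a) = y ν'(a)` for all `a`; `θ ≠ σ ^ k` makes `ν ≠ ν'`,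
so both sides vanish. On the right the automorphisms to separate are `1` and `θ`. -/
theorem leftIdealizer_twistedPair {σ θ : L ≃ₐ[K] L} (hσ : ∀ ρ, ρ ∈ Subgroup.zpowers σ)
    (hm : 2 < orderOf σ) {k : ℕ} (hk : 1 ≤ k) (hk' : k < orderOf σ) (hθ : θ ≠ σ ^ k)
    {η : L} (hη : η ≠ 0) :
    leftIdealizer (coeffCode σ k (TwistedPair θ η)) =
      (fun c => galMonomial c (1 : L ≃ₐ[K] L)) '' {c | θ c = c} := by
  have h0 : TwistedPair θ η 0 0 := by simp [TwistedPair]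
  refine Set.Subset.antisymm (fun g hg => ?_) ?_
  · have key : g = galMonomial (galCoeff g 1) 1 := by
      rcases hk.eq_or_lt with rfl | hk2
      · refine eq_galMonomial_one hσ fun i hi hi' => ?_
        have h (i : ℕ) (hi : 1 < i) (hi' : i < orderOf σ) :
            galCoeff g (σ ^ i) = 0 ∧ galCoeff g (σ ^ (i - 1)) = 0 := by
          rw [pow_one] at hθ
          have hne : σ ^ i ≠ σ ^ (i - 1) * θ := by
            conv_lhs => rw [← Nat.sub_add_cancel hi.le, pow_succ]
            simpa using hθ.symm
          have := eq_zero_of_mul_eq_mul hne (x := galCoeff g (σ ^ i))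
            (y := -(galCoeff g (σ ^ (i - 1)) * (σ ^ (i - 1)) η)) fun a => by
              have h := (hg _ (twist_mem_coeffCode le_rfl hk' θ η a)).2 i hi hi'
              rw [mul_add, galCoeff_add, galCoeff_mul_galMonomial, galCoeff_mul_galMonomial,
                ← pow_sub σ hi.le, inv_one, mul_one, map_mul] at h
              rw [AlgEquiv.mul_apply]
              linear_combination h
          simpa [hη, -AlgEquiv.coe_pow] using this
        -- Exponent `1` is reached only as the predecessor of `2`.
        rcases hi.eq_or_lt with rfl | hi
        · simpa using (h 2 one_lt_two hm).2
        · exact (h i hi hi').1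
      · refine eq_galMonomial_one_of_mem_leftIdealizer hσ hk2 hk' h0
          (fun j hj hjk u v h => ?_) hg
        have hne : σ ^ (k - j) ≠ θ * (σ ^ j)⁻¹ := by
          rw [pow_sub σ hjk.le]
          simpa using hθ.symm
        have := eq_zero_of_mul_eq_mul hne (x := v) (y := η * θ u) fun a => by
          rw [h a, AlgEquiv.mul_apply, map_mul, mul_assoc]
        simpa [hη, and_comm] using this
    -- Testing the scalar on the element with `a = 1` gives `c η = η θ(c)`.
    refine ⟨galCoeff g 1, ?_, key.symm⟩
    have h := (hg _ (twist_mem_coeffCode hk hk' θ η 1)).1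
    rw [key, TwistedPair, galCoeff_galMonomial_one_mul, galCoeff_galMonomial_one_mul,
      (twist_mem_coeffCode hk hk' θ η 1).1] at h
    have hk1 : (1 : L ≃ₐ[K] L) ≠ σ ^ k := by simpa using pow_ne_pow_of_lt hk hk'
    simp only [galCoeff_add, galCoeff_galMonomial, if_true, if_neg hk1, add_zero, map_one,
      mul_one] at h
    rw [mul_comm] at h
    exact (mul_left_cancel₀ hη h).symm
  · rintro _ ⟨c, hc, rfl⟩
    exact galMonomial_mem_leftIdealizer_twistedPair σ θ k (Or.inr hc)

theorem rightIdealizer_twistedPair {σ θ : L ≃ₐ[K] L} (hσ : ∀ ρ, ρ ∈ Subgroup.zpowers σ)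
    (hm : 2 < orderOf σ) {k : ℕ} (hk : 1 ≤ k) (hk' : k < orderOf σ) (hθ : θ ≠ 1)
    {η : L} (hη : η ≠ 0) :
    rightIdealizer (coeffCode σ k (TwistedPair θ η)) =
      (fun c => galMonomial c (1 : L ≃ₐ[K] L)) '' {c | θ c = (σ ^ k) c} := by
  have h0 : TwistedPair θ η 0 0 := by simp [TwistedPair]
  refine Set.Subset.antisymm (fun g hg => ?_) ?_
  · have key : g = galMonomial (galCoeff g 1) 1 := by
      rcases hk.eq_or_lt with rfl | hk2
      · refine eq_galMonomial_one hσ fun i hi hi' => ?_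
        have h (i : ℕ) (hi : 1 < i) (hi' : i < orderOf σ) :
            galCoeff g (σ ^ i) = 0 ∧ galCoeff g (σ ^ (i - 1)) = 0 := by
          have hs : (σ ^ 1)⁻¹ * σ ^ i = σ ^ (i - 1) := by
            rw [inv_mul_eq_iff_eq_mul, ← pow_add, Nat.add_sub_cancel' hi.le]
          have := eq_zero_of_mul_eq_mul hθ.symm (x := galCoeff g (σ ^ i))
            (y := -(η * σ (galCoeff g (σ ^ (i - 1))))) fun a => by
              have h := (hg _ (twist_mem_coeffCode le_rfl hk' θ η a)).2 i hi hi'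
              rw [add_mul, galCoeff_add, galCoeff_galMonomial_mul, galCoeff_galMonomial_mul,
                hs, inv_one, one_mul, pow_one, AlgEquiv.one_apply] at h
              rw [AlgEquiv.one_apply]
              linear_combination h
          simpa [hη] using this
        rcases hi.eq_or_lt with rfl | hi
        · simpa using (h 2 one_lt_two hm).2
        · exact (h i hi hi').1
      · refine eq_galMonomial_one_of_mem_rightIdealizer hσ hk2 hk' h0 (fun u v h => ?_) hg
        have := eq_zero_of_mul_eq_mul hθ.symm (x := v) (y := η * θ u) fun a => by
          have := h a
          rw [TwistedPair, map_mul] at this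
          rw [AlgEquiv.one_apply]
          linear_combination this
        simpa [hη, and_comm] using this
    refine ⟨galCoeff g 1, ?_, key.symm⟩
    have h := (hg _ (twist_mem_coeffCode hk hk' θ η 1)).1
    rw [key, TwistedPair, galCoeff_mul_galMonomial_one, galCoeff_mul_galMonomial_one,
      (twist_mem_coeffCode hk hk' θ η 1).1] at h
    have hk1 : (1 : L ≃ₐ[K] L) ≠ σ ^ k := by simpa using pow_ne_pow_of_lt hk hk'
    simp only [galCoeff_add, galCoeff_galMonomial, if_true, if_neg hk1, add_zero, map_one,
      mul_one, one_mul, AlgEquiv.one_apply] at h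
    exact (mul_left_cancel₀ hη h).symm
  · rintro _ ⟨c, hc, rfl⟩
    exact galMonomial_mem_rightIdealizer_twistedPair hc

end CoefficientCodes

/-! ### From coefficient conditions to explicit sums; additivity of the twisted code. -/

section CoefficientSums

variable {K L : Type*} [Field K] [Field L] [Algebra K L] [FiniteDimensional K L] [IsGalois K L]

theorem galCoeff_sum_range (σ : L ≃ₐ[K] L) (a : ℕ → L) {N j : ℕ} (hN : N ≤ orderOf σ)
    (hj : j < orderOf σ) :
    galCoeff (∑ i ∈ Finset.range N, galMonomial (a i) (σ ^ i)) (σ ^ j) =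
      if j < N then a j else 0 := by
  classical
  rw [galCoeff_sum]
  have h : ∀ i ∈ Finset.range N, galCoeff (galMonomial (a i) (σ ^ i)) (σ ^ j) =
      if j = i then a i else 0 := fun i hi => by
    rw [galCoeff_galMonomial]
    have : σ ^ j = σ ^ i ↔ j = i := pow_injOn_Iio_orderOf.eq_iff (Set.mem_Iio.2 hj)
      (Set.mem_Iio.2 ((Finset.mem_range.1 hi).trans_le hN))
    simp only [this]
  rw [Finset.sum_congr rfl h, Finset.sum_ite_eq]
  simp

theorem mem_coeffCode_iff {σ : L ≃ₐ[K] L} (hσ : ∀ ρ, ρ ∈ Subgroup.zpowers σ) {k : ℕ}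
    (hk : k < orderOf σ) {P : L → L → Prop} {f : Module.End K L} :
    f ∈ coeffCode σ k P ↔ ∃ a : ℕ → L, P (a 0) (a k) ∧
      f = ∑ i ∈ Finset.range (k + 1), galMonomial (a i) (σ ^ i) := by
  constructor
  · rintro ⟨h1, h2⟩
    refine ⟨fun i => galCoeff f (σ ^ i), by simpa using h1, ext_galCoeff fun ρ => ?_⟩
    obtain ⟨j, hj, rfl⟩ := exists_pow_eq_of_mem_zpowers (hσ ρ)
    rw [galCoeff_sum_range σ _ hk hj]
    split_ifs with h
    · rfl
    · exact h2 j (by omega) hj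
  · rintro ⟨a, ha, rfl⟩
    refine ⟨?_, fun j hj hj' => ?_⟩
    · rw [← pow_zero σ, galCoeff_sum_range σ a hk (by omega), galCoeff_sum_range σ a hk hk,
        if_pos (by omega), if_pos (by omega)]
      exact ha
    · rw [galCoeff_sum_range σ a hk hj', if_neg (by omega)]

/-- The additive group of the code of a twisted condition on extreme coefficients. -/
def twistedSubgroup (σ : L ≃ₐ[K] L) (k : ℕ) (θ : L ≃ₐ[K] L) (η : L) :
    AddSubgroup (Module.End K L) where
  carrier := coeffCode σ k (TwistedPair θ η)
  zero_mem' := ⟨by simp [TwistedPair], by simp⟩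
  add_mem' := fun ⟨h1, h2⟩ ⟨h3, h4⟩ => by
    rw [TwistedPair] at h1 h3
    exact ⟨by rw [TwistedPair, galCoeff_add, galCoeff_add, h1, h3, map_add, mul_add],
      fun j hj hj' => by rw [galCoeff_add, h2 j hj hj', h4 j hj hj', add_zero]⟩
  neg_mem' := fun ⟨h1, h2⟩ => by
    rw [TwistedPair] at h1
    exact ⟨by rw [TwistedPair, galCoeff_neg, galCoeff_neg, h1, map_neg, mul_neg],
      fun j hj hj' => by rw [galCoeff_neg, h2 j hj hj', neg_zero]⟩

end CoefficientSums

/-! ### Powers of Frobenius, their fixed fields, and the two codes. -/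

section FiniteFields

variable (K : Type*) [Field K] [Fintype K] (L : Type*) [Field L] [Algebra K L]
  [FiniteDimensional K L]

/-- The automorphism `x ↦ x ^ #K` of `L`. -/
noncomputable abbrev frob : L ≃ₐ[K] L := FiniteField.frobeniusAlgEquivOfAlgebraic K L

variable {L}

theorem frob_pow_apply (i : ℕ) (x : L) : (frob K L ^ i) x = x ^ (Fintype.card K ^ i) := by
  rw [AlgEquiv.coe_pow, FiniteField.coe_frobeniusAlgEquivOfAlgebraic_iterate]

theorem qMonomial_eq_galMonomial (a : L) (i j : ℕ) :
    qMonomial K a (i * j) = galMonomial a ((frob K L ^ j) ^ i) := by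
  ext x
  rw [qMonomial_apply, galMonomial_apply, ← pow_mul, frob_pow_apply, mul_comm i j]

theorem mem_zpowers_frob_pow [Finite L] {s : ℕ} (hs : Nat.Coprime (Module.finrank K L) s)
    (ρ : L ≃ₐ[K] L) : ρ ∈ Subgroup.zpowers (frob K L ^ s) := by
  obtain ⟨i, rfl⟩ := (FiniteField.bijective_frobeniusAlgEquivOfAlgebraic_pow K L).2 ρ
  have hmem : frob K L ∈ Subgroup.zpowers (frob K L ^ s) :=
    mem_zpowers_pow_iff.2
      (by rw [FiniteField.orderOf_frobeniusAlgEquivOfAlgebraic]; exact hs.symm)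
  exact Subgroup.pow_mem _ hmem _

theorem orderOf_frob_pow [Finite L] (s : ℕ) :
    orderOf (frob K L ^ s) = Module.finrank K L / Nat.gcd (Module.finrank K L) s := by
  rw [orderOf_pow, FiniteField.orderOf_frobeniusAlgEquivOfAlgebraic]

/-- By Artin, `L` has degree `m / g` over the fixed field of `frob ^ a`; counting `L` over this
field and over `K` and taking `m / g`-th roots gives its size. -/
theorem ncard_fixed_frob_pow [Finite L] (a : ℕ) :
    {c : L | (frob K L ^ a) c = c}.ncard =
      Fintype.card K ^ Nat.gcd (Module.finrank K L) a := by
  have hpos : 0 < Module.finrank K L := Module.finrank_pos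
  set m := Module.finrank K L with hm
  set g := Nat.gcd m a with hg
  have hgm : g ∣ m := Nat.gcd_dvd_left _ _
  let S := Subgroup.zpowers (frob K L ^ a)
  let F := IntermediateField.fixedField S
  have hset : {c : L | (frob K L ^ a) c = c} = (F : Set L) := by
    ext c
    constructor
    · intro hc
      rintro ⟨ρ, hρ⟩
      have : S ≤ MulAction.stabilizer (L ≃ₐ[K] L) c := Subgroup.zpowers_le.2 hc
      exact this hρ
    · intro hc
      exact hc ⟨_, Subgroup.mem_zpowers _⟩
  have hfr : Module.finrank F L = m / g := by
    rw [IntermediateField.finrank_fixedField_eq_card, Nat.card_zpowers, orderOf_frob_pow]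
  have h1 : Nat.card L = Nat.card F ^ (m / g) := by
    rw [← hfr]
    exact Module.natCard_eq_pow_finrank
  have h2 : Nat.card L = (Fintype.card K ^ g) ^ (m / g) := by
    rw [← pow_mul, Nat.mul_div_cancel' hgm, Fintype.card_eq_nat_card]
    exact Module.natCard_eq_pow_finrank
  have hne : m / g ≠ 0 := (Nat.div_pos (Nat.le_of_dvd hpos hgm)
    (Nat.pos_of_dvd_of_pos hgm hpos)).ne'
  rw [hset]
  exact Nat.pow_left_injective hne (h1.symm.trans h2)

theorem card_le_ncard_of_forall_galMonomial_mem {S : Set (Module.End K L)}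
    (h : ∀ c : L, galMonomial c 1 ∈ S) : Fintype.card K ^ Module.finrank K L ≤ S.ncard := by
  have : Finite (Module.End K L) := Module.finite_of_finite K
  rw [Fintype.card_eq_nat_card, ← Module.natCard_eq_pow_finrank (K := K) (V := L),
    ← Set.ncard_univ, ← Set.ncard_image_of_injective _ (galMonomial_one_injective (K := K))]
  exact Set.ncard_le_ncard (by rintro _ ⟨c, -, rfl⟩; exact h c) (Set.toFinite S)

variable [Finite L]

theorem codeD_eq {n k s : ℕ} (hk : 1 ≤ k) (hk' : k < Module.finrank K L)
    (hs : Nat.Coprime (Module.finrank K L) s) (γ : L) :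
    codeD K n k s γ = coeffCode (frob K L ^ s) k (FixedPair (frob K L ^ n) γ) := by
  have hord : k < orderOf (frob K L ^ s) := by
    rwa [orderOf_frob_pow, hs, Nat.div_one]
  have hsplit (a : ℕ → L) :
      ∑ i ∈ Finset.range (k + 1), galMonomial (a i) ((frob K L ^ s) ^ i) =
      qMonomial K (a 0) 0 + ∑ i ∈ Finset.Ico 1 k, qMonomial K (a i) (i * s) +
        qMonomial K (a k) (k * s) := by
    rw [Finset.sum_range_succ, Finset.range_eq_Ico, Finset.sum_eq_sum_Ico_succ_bot hk]
    simp only [← qMonomial_eq_galMonomial, zero_mul, zero_add]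
  have hmem (a : L) : a ∈ subfieldElems K L n ↔ (frob K L ^ n) a = a := by
    rw [frob_pow_apply]
    rfl
  ext f
  rw [mem_coeffCode_iff (mem_zpowers_frob_pow K hs) hord]
  constructor
  · rintro ⟨a, ha, b, hb, c, rfl⟩
    refine ⟨fun i => if i = 0 then a else if i = k then γ * b else c i, ?_, ?_⟩
    · simp only [if_true, if_neg (Nat.one_le_iff_ne_zero.1 hk)]
      exact ⟨(hmem a).1 ha, b, (hmem b).1 hb, rfl⟩
    · rw [hsplit]
      simp only [if_true, if_neg (Nat.one_le_iff_ne_zero.1 hk)]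
      congr 2
      refine Finset.sum_congr rfl fun i hi => ?_
      rw [Finset.mem_Ico] at hi
      rw [if_neg (by omega), if_neg (by omega)]
  · rintro ⟨a, ⟨h1, b, hb, h2⟩, rfl⟩
    exact ⟨a 0, (hmem _).2 h1, b, (hmem b).2 hb, a, by rw [hsplit, h2]⟩

theorem codeH_eq {k t : ℕ} (hk : 1 ≤ k) (hk' : k < Module.finrank K L)
    (ht : Nat.Coprime (Module.finrank K L) t) (η : L) (h : ℕ) :
    codeH K k t η h = coeffCode (frob K L ^ t) k (TwistedPair (frob K L ^ h) η) := by
  have hord : k < orderOf (frob K L ^ t) := by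
    rwa [orderOf_frob_pow, ht, Nat.div_one]
  ext f
  rw [mem_coeffCode_iff (mem_zpowers_frob_pow K ht) hord]
  simp only [TwistedPair, Finset.sum_range_succ _ k, ← qMonomial_eq_galMonomial, frob_pow_apply]
  constructor
  · rintro ⟨a, rfl⟩
    refine ⟨Function.update a k (η * a 0 ^ Fintype.card K ^ h), ?_, ?_⟩
    · rw [Function.update_self, Function.update_of_ne (by omega)]
    · rw [Function.update_self]
      congr 1
      refine Finset.sum_congr rfl fun i hi => ?_
      rw [Function.update_of_ne (Finset.mem_range.1 hi).ne]
  · rintro ⟨a, ha, rfl⟩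
    exact ⟨a, by rw [ha]⟩

end FiniteFields

/-- A parity obstruction: everything is divisible by `n`, and after dividing, the congruence mod 2
reads odd = odd + odd. -/
theorem false_of_gcd_eq {n k t h r : ℕ} (hk : 1 ≤ k) (hk' : k < 2 * n)
    (ht : Nat.gcd (2 * n) t = 1) (hh : Nat.gcd (2 * n) h = n) (hr : Nat.gcd (2 * n) r = n)
    (hmod : h ≡ r + k * t [MOD 2 * n]) : False := by
  have hn : 0 < n := by omega
  have hdh : n ∣ h := hh ▸ Nat.gcd_dvd_right (2 * n) h
  have hdr : n ∣ r := hr ▸ Nat.gcd_dvd_right (2 * n) r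
  have hdkt : n ∣ k * t :=
    (Nat.dvd_add_right hdr).1 (((hmod.of_mul_left 2).dvd_iff dvd_rfl).1 hdh)
  have hdk : n ∣ k :=
    (Nat.Coprime.coprime_dvd_left (Dvd.intro_left 2 rfl) ht).dvd_of_dvd_mul_right hdkt
  obtain ⟨x, rfl⟩ := hdk
  obtain ⟨u, rfl⟩ := hdh
  obtain ⟨v, rfl⟩ := hdr
  have hx : x = 1 := by
    have : x < 2 := by
      by_contra hx
      nlinarith
    have : x ≠ 0 := by rintro rfl; simp at hk
    omega
  subst hx
  -- For even `w` the gcd would be `2 * n`.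
  have odd {w : ℕ} (hw : Nat.gcd (2 * n) (n * w) = n) : w % 2 = 1 := by
    by_contra hw2
    obtain ⟨w', rfl⟩ : 2 ∣ w := by omega
    rw [Nat.gcd_eq_left ⟨w', by ring⟩] at hw
    omega
  have htodd : t % 2 = 1 := by
    by_contra ht2
    have : 2 ∣ Nat.gcd (2 * n) t := Nat.dvd_gcd (Dvd.intro n rfl) (by omega)
    omega
  have hmod' : u ≡ v + t [MOD 2] := by
    refine Nat.ModEq.mul_left_cancel' hn.ne' ?_
    rw [mul_comm n 2]
    convert hmod using 1
    ring
  have hu := odd hh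
  have hv := odd hr
  unfold Nat.ModEq at hmod'
  omega

end RankMetric

theorem theorem6 {K L : Type*} [Field K] [Fintype K] [Field L] [Algebra K L]
    (n k s t h : ℕ) (hn : 2 ≤ n) (hk : 1 ≤ k) (hk' : k ≤ 2 * n - 1)
    (hs : Nat.gcd (2 * n) s = 1) (ht : Nat.gcd (2 * n) t = 1)
    (β : Module.Basis (Fin (2 * n)) K L)
    (γ η : L) (hγ : ¬ IsSquare (Algebra.norm K γ)) (hη : Algebra.norm K η ≠ 1) :
    ¬ RankMetric.Equivalent (RankMetric.matrixCode β (RankMetric.codeD K n k s γ))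
        (RankMetric.matrixCode β (RankMetric.codeH K k t η h)) := by
  open RankMetric in
  intro hequiv
  have hfin : FiniteDimensional K L := β.finiteDimensional_of_finite
  have hL : Finite L := Module.finite_of_finite K
  have hrank : Module.finrank K L = 2 * n := by simp [Module.finrank_eq_card_basis β]
  have hklt : k < 2 * n := by omega
  have hord (s : ℕ) (hs : Nat.gcd (2 * n) s = 1) : orderOf (frob K L ^ s) = 2 * n := by
    rw [orderOf_frob_pow, hrank, hs, Nat.div_one]
  have hs' : Nat.Coprime (Module.finrank K L) s := hrank ▸ hs
  have ht' : Nat.Coprime (Module.finrank K L) t := hrank ▸ ht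
  have hσ := mem_zpowers_frob_pow K hs'
  have hτ := mem_zpowers_frob_pow K ht'
  have hγ0 : γ ≠ 0 := by
    rintro rfl
    exact hγ (by rw [Algebra.norm_zero]; exact IsSquare.zero)
  have hq : 1 < Fintype.card K := Fintype.one_lt_card
  have hφ : frob K L ^ n ≠ 1 := by
    refine pow_ne_one_of_lt_orderOf (by omega) ?_
    rw [FiniteField.orderOf_frobeniusAlgEquivOfAlgebraic, hrank]
    omega
  have hcardF : {c : L | (frob K L ^ n) c = c}.ncard = Fintype.card K ^ n := by
    rw [ncard_fixed_frob_pow, hrank, Nat.gcd_mul_left_left]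
  rw [codeD_eq K hk (hrank ▸ hklt) hs', codeH_eq K hk (hrank ▸ hklt) ht'] at hequiv
  obtain ⟨hl, hr⟩ := Equivalent.ncard_idealizers β
    (twistedSubgroup (frob K L ^ t) k (frob K L ^ h) η)
    (S := coeffCode _ k (FixedPair _ γ)) ⟨⟨by simp, 0, map_zero _, by simp⟩, by simp⟩ hequiv
  change (leftIdealizer (coeffCode _ k (TwistedPair _ η))).ncard = _ at hl
  change (rightIdealizer (coeffCode _ k (TwistedPair _ η))).ncard = _ at hr
  rw [leftIdealizer_fixedPair hσ (by rw [hord s hs]; omega) hk (by rwa [hord s hs]) hφ hγ0,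
    Set.ncard_image_of_injective _ galMonomial_one_injective, hcardF] at hl
  rw [rightIdealizer_fixedPair hσ (by rw [hord s hs]; omega) hk (by rwa [hord s hs]) hφ hγ0,
    Set.ncard_image_of_injective _ galMonomial_one_injective, hcardF] at hr
  -- Disposes of the degenerate cases: all scalars of `L` would give at least `q^(2n)` elements.
  have hlarge {S : Set (Module.End K L)} (hS : S.ncard = Fintype.card K ^ n)
      (hmem : ∀ c : L, galMonomial c 1 ∈ S) : False := by
    have h1 := card_le_ncard_of_forall_galMonomial_mem K hmem
    rw [hS, hrank, Nat.pow_le_pow_iff_right hq] at h1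
    omega
  by_cases hη0 : η = 0
  · exact hlarge hl fun c => galMonomial_mem_leftIdealizer_twistedPair _ _ k (Or.inl hη0)
  by_cases hθ1 : frob K L ^ h = 1
  · exact hlarge hl fun c => galMonomial_mem_leftIdealizer_twistedPair _ _ k
      (Or.inr (by rw [hθ1, AlgEquiv.one_apply]))
  by_cases hθk : frob K L ^ h = (frob K L ^ t) ^ k
  · exact hlarge hr fun c => galMonomial_mem_rightIdealizer_twistedPair (by rw [hθk])
  rw [leftIdealizer_twistedPair hτ (by rw [hord t ht]; omega) hk (by rwa [hord t ht]) hθk hη0,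
    Set.ncard_image_of_injective _ galMonomial_one_injective, ncard_fixed_frob_pow, hrank] at hl
  -- A natural number `r` standing for `h - k * t` modulo `2 * n`, so that the right idealizer
  -- becomes a fixed field.
  obtain ⟨⟨r, _⟩, hrr⟩ := (FiniteField.bijective_frobeniusAlgEquivOfAlgebraic_pow K L).2
    (((frob K L ^ t) ^ k)⁻¹ * frob K L ^ h)
  have hrr' : frob K L ^ h = (frob K L ^ t) ^ k * frob K L ^ r := by
    rw [show frob K L ^ r = _ from hrr, mul_inv_cancel_left]
  have hset : {c : L | (frob K L ^ h) c = ((frob K L ^ t) ^ k) c} =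
      {c : L | (frob K L ^ r) c = c} := by
    ext c
    simp only [Set.mem_ofPred_eq]
    rw [hrr', AlgEquiv.mul_apply, EmbeddingLike.apply_eq_iff_eq]
  rw [rightIdealizer_twistedPair hτ (by rw [hord t ht]; omega) hk (by rwa [hord t ht]) hθ1 hη0,
    Set.ncard_image_of_injective _ galMonomial_one_injective, hset, ncard_fixed_frob_pow,
    hrank] at hr
  refine false_of_gcd_eq hk hklt ht (Nat.pow_right_injective hq hl)
    (Nat.pow_right_injective hq hr) ?_
  rw [← pow_mul, ← pow_add, pow_eq_pow_iff_modEq,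
    FiniteField.orderOf_frobeniusAlgEquivOfAlgebraic, hrank] at hrr'
  rwa [add_comm, mul_comm k t]
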